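/- Let $\varphi:\mathbb R\to\mathbb R$ be an Orlicz $N$-function, i.e. continuous, even, convex, increasing on $(0,\infty)$, with $\varphi(0)=0$, $\varphi(x)/x\to0$ as $x\to0$ and $\varphi(x)/x\to\infty$ as $x\to\infty$. Let $\varphi^{(-1)}$ denote the inverse of $\varphi$ on $[0,\infty)$, and assume $\varphi^{(-1)}(1)=1$. For a real random variable $Y$ put $$\tau_{\tilde\varphi}(Y)=\sup_{p\ge1}\frac{\|Y\|_p}{\varphi^{(-1)}(p)},\qquad \|Y\|_p=(\mathbb E|Y|^p)^{1/p}.$$ **Theorem (Uniform bound for PCA).** Let $\mathcal H$ be a (real or complex) Hilbert space, let $d\ge1$, let $\mathcal P_d$ be the set of orthogonal projections of $\mathcal H$ with $d$-dimensional range, and let $\ell(P,x)=\|Px-x\|^2$ for $P\in\mathcal P_d$, $x\in\mathcal H$. Let $X_1,\dots,X_n$ be i.i.d. (strongly measurable) random variables with values in $\mathcal H$ such that $K_3:=\tau_{\tilde\varphi}(\|X_1\|^2)<\infty$, and let $\delta>0$ satisfy $n\ge\ln(1/\delta)\ge1$. Then $\ell(P,X_1)$ is integrable for every $P\in\mathcal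 P_d$, and with probability at least $1-\delta$, $$\sup_{P\in\mathcal P_d}\Big(\frac1n\sum_{i=1}^n\ell(P,X_i)-\mathbb E[\ell(P,X_1)]\Big)\le 12\sqrt d\,e\,K_3\sqrt{\frac{\ln(1/\delta)}{n}}.$$ -/

import Mathlib

open MeasureTheory ProbabilityTheory Set Filter Topology
open scoped ENNReal

/-- An Orlicz N-function: continuous, even, convex, increasing on the positive half-line,
vanishing at `0`, with `φ x / x → 0` as `x → 0` and `φ x / x → ∞` as `x → ∞`.
Increasing is read in the weak sense, the more general reading. -/
structure IsOrliczNFunction (φ : ℝ → ℝ) : Prop where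
  continuous : Continuous φ
  even : Function.Even φ
  convex : ConvexOn ℝ univ φ
  mono : MonotoneOn φ (Ioi 0)
  map_zero : φ 0 = 0
  tendsto_zero : Tendsto (fun x => φ x / x) (𝓝[≠] 0) (𝓝 0)
  tendsto_atTop : Tendsto (fun x => φ x / x) atTop atTop

/-- The inverse function `φ^{(-1)}` of `φ`, taken on the half-line `[0, ∞)`. For an Orlicz
N-function, `orliczInv φ y` is the unique `x ≥ 0` with `φ x = y` for each `y > 0`; see
`IsOrliczNFunction.orliczInv_spec` and `IsOrliczNFunction.orliczInv_unique`. -/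
noncomputable def orliczInv (φ : ℝ → ℝ) : ℝ → ℝ :=
  Function.invFunOn φ (Ici 0)

/-- The inverse takes values in `[0, ∞)` and is a right inverse of `φ` there. -/
theorem IsOrliczNFunction.orliczInv_spec {φ : ℝ → ℝ} (h : IsOrliczNFunction φ) {y : ℝ}
    (hy : 0 ≤ y) : 0 ≤ orliczInv φ y ∧ φ (orliczInv φ y) = y := by
  have hex : ∃ x ∈ Ici (0 : ℝ), φ x = y := by
    obtain ⟨b, hb, hb1⟩ :=
      ((h.tendsto_atTop.eventually_ge_atTop 1).and (eventually_ge_atTop (y + 1))).exists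
    have hbpos : 0 < b := by linarith
    have hle : b ≤ φ b := by
      have := (le_div_iff₀ hbpos).1 hb
      linarith
    obtain ⟨x, hx, hxy⟩ := intermediate_value_Icc hbpos.le h.continuous.continuousOn
      (show y ∈ Icc (φ 0) (φ b) from ⟨by rw [h.map_zero]; exact hy, by linarith⟩)
    exact ⟨x, hx.1, hxy⟩
  exact ⟨Function.invFunOn_mem hex, Function.invFunOn_eq hex⟩

/-- At positive values the preimage in `[0, ∞)` is unique. -/
theorem IsOrliczNFunction.orliczInv_unique {φ : ℝ → ℝ} (h : IsOrliczNFunction φ) {x y : ℝ}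
    (hx : 0 ≤ x) (hy : 0 ≤ y) (hpos : 0 < φ x) (hxy : φ x = φ y) : x = y := by
  have key : ∀ a b : ℝ, 0 ≤ a → a < b → 0 < φ b → φ a < φ b := by
    intro a b ha hab hb
    have hb0 : 0 < b := lt_of_le_of_lt ha hab
    have hc := h.convex.2 (mem_univ b) (mem_univ (0 : ℝ)) (show 0 ≤ a / b by positivity)
      (show 0 ≤ 1 - a / b by rw [sub_nonneg, div_le_one hb0]; exact hab.le) (by ring)
    have hlt : a / b < 1 := by rwa [div_lt_one hb0]
    simp only [smul_eq_mul, mul_zero, add_zero, h.map_zero] at hc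
    rw [div_mul_cancel₀ _ hb0.ne'] at hc
    nlinarith
  rcases lt_trichotomy x y with hlt | heq | hlt
  · exact absurd hxy (key x y hx hlt (hxy ▸ hpos)).ne
  · exact heq
  · exact absurd hxy.symm (key y x hy hlt hpos).ne

/-- The moment norm `τ_φ̃(Y) = sup_{p ≥ 1} ‖Y‖_p / φ^{(-1)}(p)`, with values in `[0, ∞]`;
here `p` ranges over the reals. -/
noncomputable def momentNorm {Ω : Type*} [MeasurableSpace Ω] (φ : ℝ → ℝ) (μ : Measure Ω)
    (Y : Ω → ℝ) : ℝ≥0∞ :=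
  ⨆ (p : ℝ) (_ : 1 ≤ p), eLpNorm Y (ENNReal.ofReal p) μ / ENNReal.ofReal (orliczInv φ p)

/-- The set of orthogonal projections (self-adjoint idempotents) with `d`-dimensional range. -/
def orthProjections (𝕜 : Type*) (H : Type*) [RCLike 𝕜] [NormedAddCommGroup H]
    [InnerProductSpace 𝕜 H] [CompleteSpace H] (d : ℕ) : Set (H →L[𝕜] H) :=
  {P | IsStarProjection P ∧ Module.rank 𝕜 (LinearMap.range (P : H →ₗ[𝕜] H)) = d}

/-- The reconstruction error `ℓ(P, x) = ‖P x - x‖²`. -/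
noncomputable def reconstructionError {𝕜 : Type*} {H : Type*} [RCLike 𝕜] [NormedAddCommGroup H]
    [InnerProductSpace 𝕜 H] (P : H →L[𝕜] H) (x : H) : ℝ :=
  ‖P x - x‖ ^ 2

/-! The reconstruction error is linear in a feature vector. With `V x = ‖x‖² a + T x`, where `T x`
plays the role of `x ⊗ x̄` and `a` is a unit vector orthogonal to the range of `T`, a projection
with range basis `e_k` has error `⟪A, V x⟫` for `A = a - ∑ T (e_k)`, and `‖A‖ = √(1 + d)`. By
Cauchy–Schwarz the supremum over projections is at most `√(1 + d)` times the deviation of the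
empirical mean of `V (X i)`, so one event serves every `P`.

Since `‖V x‖ = √2 ‖x‖²` and convexity gives `φ^{(-1)}(p) ≤ p` for `p ≥ 1`, the `k`-th moment norm of
`V (X i)` is at most `√2 K k`. Such vectors satisfy a dimension-free Bernstein bound: `cosh ‖·‖` of
a sum of independent centred vectors grows in mean by a factor at most `1 + E(exp ‖Z‖ - 1 - ‖Z‖)`
per summand (`integral_cosh_norm_add_le`), and Markov's inequality finishes. The constant is `6 · √2
· √(1 + d) ≤ 12 √d`. -/

/-! ### Convexity of `cosh √s` and the one-step inequality. -/

theorem hasSum_cosh_sqrt {s : ℝ} (hs : 0 ≤ s) :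
    HasSum (fun k : ℕ => s ^ k / ((2 * k).factorial : ℝ)) (Real.cosh √s) := by
  have h := Real.hasSum_cosh √s
  simpa only [pow_mul, Real.sq_sqrt hs] using h

/-- The power series in `s` has nonnegative coefficients, and each `s ^ k` is convex on the
half-line. -/
theorem convexOn_cosh_sqrt : ConvexOn ℝ (Ici 0) (fun s : ℝ => Real.cosh √s) := by
  refine ⟨convex_Ici 0, fun x hx y hy a b ha hb hab => ?_⟩
  have hxy : 0 ≤ a • x + b • y := (convex_Ici (0 : ℝ)) hx hy ha hb hab
  refine hasSum_le (fun k => ?_) (hasSum_cosh_sqrt hxy)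
    (((hasSum_cosh_sqrt hx).const_smul a).add ((hasSum_cosh_sqrt hy).const_smul b))
  have h := (convexOn_pow k).2 hx hy ha hb hab
  simp only [smul_eq_mul] at h ⊢
  rw [← mul_div_assoc, ← mul_div_assoc, ← add_div]
  gcongr

section Cosh

variable {E : Type*} [NormedAddCommGroup E] [InnerProductSpace ℝ E]

/-- One-step estimate for `cosh ‖·‖` in a Hilbert space: the first-order term is linear in the
increment. -/
theorem cosh_norm_add_le (x w : E) :
    Real.cosh ‖x + w‖ ≤ Real.cosh ‖x‖ + inner ℝ ((Real.sinh ‖x‖ / ‖x‖) • x) w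
      + Real.cosh ‖x‖ * (Real.exp ‖w‖ - 1 - ‖w‖) := by
  have hb : ‖w‖ ≤ Real.sinh ‖w‖ := Real.self_le_sinh_iff.2 (norm_nonneg w)
  have hexp : Real.exp ‖w‖ = Real.cosh ‖w‖ + Real.sinh ‖w‖ := (Real.cosh_add_sinh _).symm
  rcases eq_or_ne x 0 with rfl | hx
  · simp; linarith
  rcases eq_or_ne w 0 with rfl | hw
  · simp
  have ha0 : 0 < ‖x‖ := norm_pos_iff.2 hx
  have hb0 : 0 < ‖w‖ := norm_pos_iff.2 hw
  set a := ‖x‖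
  set b := ‖w‖
  set p := inner ℝ x w
  -- `c` is the cosine of the angle between `x` and `w`. Then `‖x + w‖²` is a convex combination of
  -- `(a + b)²` and `(a - b)²`, so convexity gives `cosh ‖x + w‖ ≤ cosh a cosh b + c sinh a sinh b`.
  obtain ⟨c, hc⟩ : ∃ c, p = a * b * c := ⟨p / (a * b), by field_simp⟩
  have hab : 0 < a * b := mul_pos ha0 hb0
  have hp : |p| ≤ a * b := abs_real_inner_le_norm x w
  obtain ⟨h1, h2⟩ := abs_le.1 hp
  have hc1 : c ≤ 1 := by nlinarith
  have hc2 : -1 ≤ c := by nlinarith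
  have hsq : ‖x + w‖ ^ 2 = ((1 + c) / 2) * (a + b) ^ 2 + ((1 - c) / 2) * (a - b) ^ 2 := by
    rw [norm_add_sq_real]
    change a ^ 2 + 2 * p + b ^ 2 = _
    rw [hc]; ring
  have hconv := convexOn_cosh_sqrt.2 (mem_Ici.2 (sq_nonneg (a + b))) (mem_Ici.2 (sq_nonneg (a - b)))
    (show 0 ≤ (1 + c) / 2 by linarith) (show 0 ≤ (1 - c) / 2 by linarith) (by ring)
  simp only [smul_eq_mul] at hconv
  rw [← hsq, Real.sqrt_sq (norm_nonneg _), Real.sqrt_sq_eq_abs, Real.sqrt_sq_eq_abs,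
    Real.cosh_abs, Real.cosh_abs, Real.cosh_add, Real.cosh_sub] at hconv
  have hlin : inner ℝ ((Real.sinh a / a) • x) w = Real.sinh a * b * c := by
    rw [real_inner_smul_left]
    change Real.sinh a / a * p = _
    rw [hc]; field_simp
  rw [hlin, hexp]
  have hs : Real.sinh a ≤ Real.cosh a := (Real.sinh_lt_cosh a).le
  have hs0 : 0 ≤ Real.sinh a := Real.sinh_nonneg_iff.2 ha0.le
  -- This product is exactly the gap between the claimed bound and the one from convexity.
  have e1 : 0 ≤ (Real.cosh a - Real.sinh a * c) * (Real.sinh b - b) := by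
    apply mul_nonneg _ (by linarith)
    nlinarith
  nlinarith

end Cosh

/-! ### Exponential moments of sums of independent centred vectors. -/

section Prob

variable {Ω : Type*} [MeasurableSpace Ω] {μ : Measure Ω} [IsProbabilityMeasure μ]
  {E : Type*} [NormedAddCommGroup E] [InnerProductSpace ℝ E] [CompleteSpace E]
  [SecondCountableTopology E] [MeasurableSpace E] [BorelSpace E]

/-- Integrating the one-step inequality, independence and `E W = 0` kill the linear term, and
independence factors the remainder. -/
theorem integral_cosh_norm_add_le {S W : Ω → E} (hSW : IndepFun S W μ)
    (hSm : AEMeasurable S μ) (hWm : AEMeasurable W μ)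
    (hS : Integrable (fun ω => Real.cosh ‖S ω‖) μ)
    (hW : Integrable (fun ω => Real.exp ‖W ω‖) μ) (hW0 : ∫ ω, W ω ∂μ = 0) :
    Integrable (fun ω => Real.cosh ‖S ω + W ω‖) μ ∧
    ∫ ω, Real.cosh ‖S ω + W ω‖ ∂μ ≤ (∫ ω, Real.cosh ‖S ω‖ ∂μ) *
      (1 + ∫ ω, (Real.exp ‖W ω‖ - 1 - ‖W ω‖) ∂μ) := by
  have hWn : Integrable (fun ω => ‖W ω‖) μ := by
    refine hW.mono' hWm.norm.aestronglyMeasurable (ae_of_all _ fun ω => ?_)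
    have := Real.add_one_le_exp ‖W ω‖
    rw [norm_norm]; linarith
  have hWi : Integrable W μ := (integrable_norm_iff hWm.aestronglyMeasurable).1 hWn
  let h : E → E := fun x => (Real.sinh ‖x‖ / ‖x‖) • x
  have hh : Measurable h := by
    have : Measurable fun x : E => Real.sinh ‖x‖ :=
      Real.continuous_sinh.measurable.comp measurable_norm
    exact (this.div measurable_norm).smul measurable_id
  have hhS : Integrable (fun ω => h (S ω)) μ := by
    refine hS.mono' (hh.comp_aemeasurable hSm).aestronglyMeasurable (ae_of_all _ fun ω => ?_)
    have h0 : 0 ≤ Real.sinh ‖S ω‖ := Real.sinh_nonneg_iff.2 (norm_nonneg _)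
    -- The bound also holds at `S ω = 0`, where the quotient takes the default value `0`.
    have : ‖h (S ω)‖ ≤ Real.sinh ‖S ω‖ := by
      rw [norm_smul, norm_div, norm_norm, Real.norm_of_nonneg h0]
      rcases eq_or_ne ‖S ω‖ 0 with hz | hz
      · rw [hz, mul_zero]; exact hz ▸ h0
      · rw [div_mul_cancel₀ _ hz]
    exact this.trans (Real.sinh_lt_cosh _).le
  have hhSW : IndepFun (fun ω => h (S ω)) W μ := hSW.comp hh measurable_id
  have hlin : ∫ ω, inner ℝ (h (S ω)) (W ω) ∂μ = 0 := by
    have := hhSW.integral_bilin hhS hWi (innerSL ℝ)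
    rw [hW0, map_zero] at this
    exact this
  have hlini : Integrable (fun ω => inner ℝ (h (S ω)) (W ω)) μ := by
    exact hhSW.integrable_bilin hhS hWi (innerSL ℝ)
  have hg : Integrable (fun ω => Real.exp ‖W ω‖ - 1 - ‖W ω‖) μ :=
    (hW.sub (integrable_const 1)).sub hWn
  have hcm : Measurable fun x : E => Real.cosh ‖x‖ :=
    Real.continuous_cosh.measurable.comp measurable_norm
  have hgm : Measurable fun x : E => Real.exp ‖x‖ - 1 - ‖x‖ :=
    ((Real.measurable_exp.comp measurable_norm).sub_const 1).sub measurable_norm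
  have hcg : IndepFun (fun ω => Real.cosh ‖S ω‖) (fun ω => Real.exp ‖W ω‖ - 1 - ‖W ω‖) μ :=
    hSW.comp hcm hgm
  have hprod : Integrable (fun ω => Real.cosh ‖S ω‖ * (Real.exp ‖W ω‖ - 1 - ‖W ω‖)) μ :=
    hcg.integrable_mul hS hg
  have hpt := fun ω => cosh_norm_add_le (S ω) (W ω)
  have hint : Integrable (fun ω => Real.cosh ‖S ω‖ + inner ℝ (h (S ω)) (W ω)
      + Real.cosh ‖S ω‖ * (Real.exp ‖W ω‖ - 1 - ‖W ω‖)) μ := (hS.add hlini).add hprod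
  have hres : Integrable (fun ω => Real.cosh ‖S ω + W ω‖) μ := by
    refine hint.mono' (hcm.comp_aemeasurable (hSm.add hWm)).aestronglyMeasurable
      (ae_of_all _ fun ω => ?_)
    rw [Real.norm_eq_abs, abs_of_pos (Real.cosh_pos _)]
    exact hpt ω
  refine ⟨hres, (integral_mono hres hint hpt).trans_eq ?_⟩
  rw [integral_add (f := fun ω => Real.cosh ‖S ω‖ + inner ℝ (h (S ω)) (W ω)) (hS.add hlini) hprod,
    integral_add hS hlini, hlin,
    hcg.integral_fun_mul_eq_mul_integral hS.1 hg.1]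
  ring

theorem integral_cosh_norm_sum_le {ι : Type*} {Z : ι → Ω → E} (hZm : ∀ i, AEMeasurable (Z i) μ)
    (hindep : iIndepFun Z μ) (hZ : ∀ i, Integrable (fun ω => Real.exp ‖Z i ω‖) μ)
    (hZ0 : ∀ i, ∫ ω, Z i ω ∂μ = 0) {g : ℝ}
    (hg : ∀ i, ∫ ω, (Real.exp ‖Z i ω‖ - 1 - ‖Z i ω‖) ∂μ ≤ g) (s : Finset ι) :
    Integrable (fun ω => Real.cosh ‖∑ i ∈ s, Z i ω‖) μ ∧
    ∫ ω, Real.cosh ‖∑ i ∈ s, Z i ω‖ ∂μ ≤ Real.exp (s.card * g) := by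
  classical
  induction s using Finset.induction_on with
  | empty => simp
  | insert i s hi ih =>
    have hind : IndepFun (fun ω => ∑ j ∈ s, Z j ω) (Z i) μ := by
      have := hindep.indepFun_finsetSum_of_notMem₀ hZm hi
      convert this using 1
      ext ω; simp
    obtain ⟨h1, h2⟩ := integral_cosh_norm_add_le hind
      (Finset.aemeasurable_fun_sum s fun j _ => hZm j) (hZm i) ih.1 (hZ i) (hZ0 i)
    simp only [Finset.sum_insert hi, add_comm (Z i _)]
    refine ⟨h1, h2.trans ?_⟩
    rw [Finset.card_insert_of_notMem hi, Nat.cast_succ, add_mul, one_mul, Real.exp_add]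
    have hg1 : 1 + ∫ ω, (Real.exp ‖Z i ω‖ - 1 - ‖Z i ω‖) ∂μ ≤ Real.exp g := by
      have := Real.add_one_le_exp g
      linarith [hg i]
    have hnn : 0 ≤ ∫ ω, Real.cosh ‖∑ i ∈ s, Z i ω‖ ∂μ :=
      integral_nonneg fun ω => (Real.cosh_pos _).le
    have h0 : 0 ≤ ∫ ω, (Real.exp ‖Z i ω‖ - 1 - ‖Z i ω‖) ∂μ :=
      integral_nonneg fun ω => by
        have := Real.add_one_le_exp ‖Z i ω‖
        simp only [Pi.zero_apply]; linarith
    exact mul_le_mul ih.2 hg1 (by linarith) (Real.exp_pos _).le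

/-- A Chernoff bound for the norm of a sum of independent centred vectors. -/
theorem measureReal_norm_sum_ge_le {ι : Type*} [Fintype ι] {Z : ι → Ω → E}
    (hZm : ∀ i, AEMeasurable (Z i) μ)
    (hindep : iIndepFun Z μ) (hZ : ∀ i, Integrable (fun ω => Real.exp ‖Z i ω‖) μ)
    (hZ0 : ∀ i, ∫ ω, Z i ω ∂μ = 0) {g : ℝ}
    (hg : ∀ i, ∫ ω, (Real.exp ‖Z i ω‖ - 1 - ‖Z i ω‖) ∂μ ≤ g) (t : ℝ) :
    μ.real {ω | t ≤ ‖∑ i, Z i ω‖} ≤ 2 * Real.exp (Fintype.card ι * g - t) := by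
  obtain ⟨h1, h2⟩ := integral_cosh_norm_sum_le hZm hindep hZ hZ0 hg Finset.univ
  have hm := mul_meas_ge_le_integral_of_nonneg
    (ae_of_all _ fun ω => (Real.cosh_pos ‖∑ i, Z i ω‖).le) h1 (Real.exp t / 2)
  have hsub : {ω | t ≤ ‖∑ i, Z i ω‖} ⊆ {ω | Real.exp t / 2 ≤ Real.cosh ‖∑ i, Z i ω‖} := by
    intro ω hω
    -- `exp u ≤ 2 cosh u` is the source of the factor `2`.
    have : Real.exp t ≤ Real.exp ‖∑ i, Z i ω‖ := Real.exp_le_exp.2 hω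
    simp only [mem_ofPred_eq, Real.cosh_eq]
    have := Real.exp_pos (-‖∑ i, Z i ω‖)
    linarith
  have hm2 : Real.exp t / 2 * μ.real {ω | t ≤ ‖∑ i, Z i ω‖} ≤ Real.exp (Fintype.card ι * g) :=
    (mul_le_mul_of_nonneg_left (measureReal_mono hsub) (by positivity)).trans (hm.trans h2)
  rw [Real.exp_sub, ← mul_div_assoc, le_div_iff₀ (Real.exp_pos _)]
  linarith

end Prob

/-! ### From moment growth to exponential moments. -/

theorem hasSum_exp_sub_one_sub (x : ℝ) :
    HasSum (fun k : ℕ => x ^ (k + 2) / ((k + 2).factorial : ℝ)) (Real.exp x - 1 - x) := by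
  have h := NormedSpace.expSeries_div_hasSum_exp x
  rw [← Real.exp_eq_exp_ℝ, ← hasSum_nat_add_iff' 2] at h
  simpa [Finset.sum_range_succ, sub_sub] using h

theorem exp_sub_one_sub_nonneg (x : ℝ) : 0 ≤ Real.exp x - 1 - x := by
  have := Real.add_one_le_exp x
  linarith

section Moments

variable {Ω : Type*} [MeasurableSpace Ω] {μ : Measure Ω}
  {E : Type*} [NormedAddCommGroup E]

theorem lintegral_ofReal_norm_pow (Z : Ω → E) {k : ℕ} (hk : k ≠ 0) :
    ∫⁻ ω, ENNReal.ofReal (‖Z ω‖ ^ k) ∂μ = eLpNorm Z k μ ^ k := by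
  have h := eLpNorm_nnreal_pow_eq_lintegral (f := Z) (μ := μ) (p := (k : NNReal))
    (by exact_mod_cast hk)
  simp only [NNReal.coe_natCast, ENNReal.rpow_natCast, ENNReal.coe_natCast] at h
  rw [h]
  refine lintegral_congr fun ω => ?_
  rw [ENNReal.ofReal_pow (norm_nonneg _), ofReal_norm]

/-- Expanding the exponential, the term of order `j` is at most `(L (j + 1))^j / j! ≤ e (e L)^j`,
and the geometric series from `j = 2` is summed. -/
theorem lintegral_exp_norm_sub_le {Z : Ω → E} (hZ : AEStronglyMeasurable Z μ) {L : ℝ}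
    (hL : 0 ≤ L) (hL1 : Real.exp 1 * L < 1)
    (hm : ∀ k : ℕ, 1 ≤ k → eLpNorm Z k μ ≤ ENNReal.ofReal (L * (k + 1))) :
    ∫⁻ ω, ENNReal.ofReal (Real.exp ‖Z ω‖ - 1 - ‖Z ω‖) ∂μ
      ≤ ENNReal.ofReal (Real.exp 1 * ((Real.exp 1 * L) ^ 2 / (1 - Real.exp 1 * L))) := by
  set v := Real.exp 1 * L with hv
  have hv0 : 0 ≤ v := by positivity
  have hgeo : HasSum (fun k : ℕ => Real.exp 1 * v ^ (k + 2)) (Real.exp 1 * (v ^ 2 / (1 - v))) := by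
    have := ((hasSum_geometric_of_lt_one hv0 hL1).mul_left (v ^ 2)).mul_left (Real.exp 1)
    simpa only [pow_add, mul_comm (v ^ 2), div_eq_mul_inv] using this
  have hterm : ∀ k : ℕ, ∫⁻ ω, ENNReal.ofReal (‖Z ω‖ ^ (k + 2) / ((k + 2).factorial : ℝ)) ∂μ
      ≤ ENNReal.ofReal (Real.exp 1 * v ^ (k + 2)) := by
    intro k
    have hf : (0 : ℝ) < ((k + 2).factorial : ℝ) := by exact_mod_cast Nat.factorial_pos _
    simp_rw [ENNReal.ofReal_div_of_pos hf, div_eq_mul_inv]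
    rw [lintegral_mul_const'' _ (hZ.norm.aemeasurable.pow_const _).ennreal_ofReal,
      lintegral_ofReal_norm_pow Z (by omega), ← div_eq_mul_inv]
    calc eLpNorm Z (k + 2 : ℕ) μ ^ (k + 2) / ENNReal.ofReal ((k + 2).factorial : ℝ)
        ≤ ENNReal.ofReal (L * ((k + 2 : ℕ) + 1)) ^ (k + 2)
          / ENNReal.ofReal ((k + 2).factorial : ℝ) := by
          gcongr
          exact hm _ (by omega)
      _ = ENNReal.ofReal ((L * ((k + 2 : ℕ) + 1)) ^ (k + 2) / ((k + 2).factorial : ℝ)) := by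
          rw [← ENNReal.ofReal_pow (by positivity), ENNReal.ofReal_div_of_pos hf]
      _ ≤ _ := by
          apply ENNReal.ofReal_le_ofReal
          -- A single term of the series of `exp (j + 1)` is at most the whole, with `j = k + 2`.
          have h1 := Real.pow_div_factorial_le_exp (x := ((k + 2 : ℕ) + 1 : ℝ)) (by positivity) (k + 2)
          have h2 : Real.exp ((k + 2 : ℕ) + 1 : ℝ) = Real.exp 1 * Real.exp 1 ^ (k + 2) := by
            rw [Real.exp_add, ← Real.exp_nat_mul, mul_one, mul_comm]
          rw [h2] at h1
          rw [mul_pow, mul_div_assoc, hv, mul_pow]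
          calc _ ≤ L ^ (k + 2) * (Real.exp 1 * Real.exp 1 ^ (k + 2)) := by gcongr
            _ = _ := by ring
  calc ∫⁻ ω, ENNReal.ofReal (Real.exp ‖Z ω‖ - 1 - ‖Z ω‖) ∂μ
      = ∫⁻ ω, ∑' k : ℕ, ENNReal.ofReal (‖Z ω‖ ^ (k + 2) / ((k + 2).factorial : ℝ)) ∂μ := by
        refine lintegral_congr fun ω => ?_
        have h := hasSum_exp_sub_one_sub ‖Z ω‖
        rw [← h.tsum_eq, ENNReal.ofReal_tsum_of_nonneg (fun k => by positivity) h.summable]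
    _ = ∑' k : ℕ, ∫⁻ ω, ENNReal.ofReal (‖Z ω‖ ^ (k + 2) / ((k + 2).factorial : ℝ)) ∂μ :=
        lintegral_tsum fun k => ((hZ.norm.aemeasurable.pow_const _).div_const _).ennreal_ofReal
    _ ≤ ∑' k : ℕ, ENNReal.ofReal (Real.exp 1 * v ^ (k + 2)) := ENNReal.tsum_le_tsum hterm
    _ = _ := by
        rw [← ENNReal.ofReal_tsum_of_nonneg (fun k => by positivity) hgeo.summable, hgeo.tsum_eq]

theorem integral_exp_norm_sub_le [IsFiniteMeasure μ] {Z : Ω → E} (hZ : AEStronglyMeasurable Z μ)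
    {L : ℝ} (hL : 0 ≤ L) (hL1 : Real.exp 1 * L < 1)
    (hm : ∀ k : ℕ, 1 ≤ k → eLpNorm Z k μ ≤ ENNReal.ofReal (L * (k + 1))) :
    Integrable (fun ω => Real.exp ‖Z ω‖) μ ∧
    ∫ ω, (Real.exp ‖Z ω‖ - 1 - ‖Z ω‖) ∂μ
      ≤ Real.exp 1 * ((Real.exp 1 * L) ^ 2 / (1 - Real.exp 1 * L)) := by
  have hmeas : AEStronglyMeasurable (fun ω => Real.exp ‖Z ω‖ - 1 - ‖Z ω‖) μ :=
    ((Real.continuous_exp.comp_aestronglyMeasurable hZ.norm).sub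
      aestronglyMeasurable_const).sub hZ.norm
  have hnn : 0 ≤ᵐ[μ] fun ω => Real.exp ‖Z ω‖ - 1 - ‖Z ω‖ :=
    ae_of_all _ fun ω => exp_sub_one_sub_nonneg _
  have hle := lintegral_exp_norm_sub_le hZ hL hL1 hm
  have hZi : Integrable Z μ := by
    rw [← memLp_one_iff_integrable]
    refine ⟨hZ, ?_⟩
    have := hm 1 le_rfl
    rw [Nat.cast_one] at this
    exact this.trans_lt ENNReal.ofReal_lt_top
  have hint : Integrable (fun ω => Real.exp ‖Z ω‖ - 1 - ‖Z ω‖) μ :=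
    ⟨hmeas, (hasFiniteIntegral_iff_ofReal hnn).2 (hle.trans_lt ENNReal.ofReal_lt_top)⟩
  refine ⟨?_, ?_⟩
  · refine ((hint.add hZi.norm).add (integrable_const 1)).congr (ae_of_all _ fun ω => ?_)
    simp only [Pi.add_apply]; ring
  · rw [integral_eq_lintegral_of_nonneg_ae hnn hmeas]
    have h1 : 0 < 1 - Real.exp 1 * L := by linarith
    exact ENNReal.toReal_le_of_le_ofReal (by positivity) hle

variable [NormedSpace ℝ E]

/-- Centring costs at most `‖E W‖ ≤ K`, which turns `K k` into `K (k + 1)`. -/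
theorem eLpNorm_sub_integral_le [IsProbabilityMeasure μ] {W : Ω → E}
    (hW : AEStronglyMeasurable W μ) {K : ℝ} (hK : 0 ≤ K)
    (hm : ∀ k : ℕ, 1 ≤ k → eLpNorm W k μ ≤ ENNReal.ofReal (K * k)) {k : ℕ} (hk : 1 ≤ k) :
    eLpNorm (fun ω => W ω - ∫ ω', W ω' ∂μ) k μ ≤ ENNReal.ofReal (K * (k + 1)) := by
  have h1 : ‖∫ ω', W ω' ∂μ‖ₑ ≤ ENNReal.ofReal K := by
    refine (enorm_integral_le_lintegral_enorm W).trans ?_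
    rw [← eLpNorm_one_eq_lintegral_enorm]
    simpa using hm 1 le_rfl
  have h2 := eLpNorm_sub_le (p := (k : ℝ≥0∞)) hW
    (aestronglyMeasurable_const (b := ∫ ω', W ω' ∂μ) (μ := μ)) (by exact_mod_cast hk)
  rw [eLpNorm_const _ (by exact_mod_cast (by omega : k ≠ 0)) (IsProbabilityMeasure.ne_zero μ),
    measure_univ, ENNReal.one_rpow, mul_one] at h2
  refine h2.trans ((add_le_add (hm k hk) h1).trans_eq ?_)
  rw [← ENNReal.ofReal_add (by positivity) hK]
  ring_nf

end Moments

/-! ### Bernstein-type concentration of vector averages. -/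

section Concentration

variable {Ω : Type*} [MeasurableSpace Ω] {μ : Measure Ω} [IsProbabilityMeasure μ]
  {E : Type*} [NormedAddCommGroup E] [InnerProductSpace ℝ E] [CompleteSpace E]
  [MeasurableSpace E] [BorelSpace E] {n : ℕ} {W : Fin n → Ω → E} {m : E} {K δ : ℝ}

/-- Numerically the first exponent is at most `0.94 Λ`, leaving `2 exp (-1.7 Λ)`; the factor `2` is
absorbed because `log 2 ≤ 0.7 ≤ 0.7 Λ`. -/
theorem two_mul_exp_le_of_one_le {Λ r N : ℝ} (hΛ : 1 ≤ Λ) (hr0 : 0 < r) (hr1 : r ≤ 1)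
    (hN : 0 ≤ N) (hΛr : Λ = N * r ^ 2) :
    2 * Real.exp (N * (Real.exp 1 * ((0.44 * r) ^ 2 / (1 - 0.44 * r))) - 2.64 * Λ)
      ≤ Real.exp (-Λ) := by
  have he := Real.exp_one_lt_d9
  have h1 : (0.44 * r) ^ 2 / (1 - 0.44 * r) ≤ 0.1936 * r ^ 2 / 0.56 := by
    have : (0.44 * r) ^ 2 = 0.1936 * r ^ 2 := by ring
    rw [this]
    gcongr
    linarith
  have h2 : Real.exp 1 * ((0.44 * r) ^ 2 / (1 - 0.44 * r)) ≤ 0.94 * r ^ 2 :=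
    calc _ ≤ 2.7182818286 * (0.1936 * r ^ 2 / 0.56) :=
          mul_le_mul he.le h1 (div_nonneg (by positivity) (by linarith)) (by norm_num)
      _ = (2.7182818286 * 0.1936 / 0.56) * r ^ 2 := by ring
      _ ≤ _ := by gcongr; norm_num
  have h3 : N * (Real.exp 1 * ((0.44 * r) ^ 2 / (1 - 0.44 * r))) ≤ 0.94 * Λ := by
    rw [hΛr]; nlinarith
  have h4 : (2 : ℝ) = Real.exp (Real.log 2) := (Real.exp_log two_pos).symm
  nth_rewrite 1 [h4]
  rw [← Real.exp_add]
  apply Real.exp_le_exp.2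
  have := Real.log_two_lt_d9
  linarith

theorem measureReal_norm_average_sub_ge_le_of_secondCountable [SecondCountableTopology E] [NeZero n]
    (hW : ∀ i, AEStronglyMeasurable (W i) μ) (hindep : iIndepFun W μ)
    (hWm : ∀ i, ∫ ω, W i ω ∂μ = m) (hK : 0 < K)
    (hmom : ∀ i, ∀ k : ℕ, 1 ≤ k → eLpNorm (W i) k μ ≤ ENNReal.ofReal (K * k))
    (hδ : 0 < δ) (hδ1 : 1 ≤ Real.log (1 / δ)) (hn : Real.log (1 / δ) ≤ n) :
    μ.real {ω | 6 * Real.exp 1 * K * √(Real.log (1 / δ) / n) ≤ ‖(1 / (n : ℝ)) • ∑ i, W i ω - m‖}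
      ≤ δ := by
  have hn0 : (0 : ℝ) < n := by exact_mod_cast Nat.pos_of_ne_zero (NeZero.ne n)
  set Λ := Real.log (1 / δ) with hΛ
  set r := √(Λ / n) with hr
  have hr0 : 0 < r := Real.sqrt_pos.2 (by positivity)
  have hr1 : r ≤ 1 := Real.sqrt_le_one.2 ((div_le_one hn0).2 hn)
  have hΛr : Λ = n * r ^ 2 := by
    rw [hr, Real.sq_sqrt (by positivity)]; field_simp
  have he : 0 < Real.exp 1 := Real.exp_pos 1
  -- The Chernoff parameter is proportional to the deviation scale `r`. It makes `e c K = 0.44 r <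
  -- 1`, and the threshold `6 e K r` scaled by `c n` becomes `2.64 Λ`.
  set c := 0.44 * r / (Real.exp 1 * K) with hc
  have hc0 : 0 < c := by positivity
  have hcK : Real.exp 1 * (c * K) = 0.44 * r := by rw [hc]; field_simp
  let Z : Fin n → Ω → E := fun i ω => c • (W i ω - m)
  have hZm : ∀ i, AEStronglyMeasurable (Z i) μ := fun i =>
    ((hW i).sub aestronglyMeasurable_const).const_smul c
  have hWi : ∀ i, Integrable (W i) μ := fun i => by
    rw [← memLp_one_iff_integrable]
    refine ⟨hW i, ?_⟩
    have := hmom i 1 le_rfl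
    rw [Nat.cast_one] at this
    exact this.trans_lt ENNReal.ofReal_lt_top
  have hZ0 : ∀ i, ∫ ω, Z i ω ∂μ = 0 := fun i => by
    simp only [Z]
    rw [integral_smul, integral_sub (hWi i) (integrable_const m), hWm i]
    simp
  have hZind : iIndepFun Z μ :=
    hindep.comp (fun _ x => c • (x - m)) fun _ => by fun_prop
  have hZmom : ∀ i, ∀ k : ℕ, 1 ≤ k → eLpNorm (Z i) k μ ≤ ENNReal.ofReal (c * K * (k + 1)) := by
    intro i k hk
    have h1 := eLpNorm_sub_integral_le (hW i) hK.le (hmom i) hk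
    rw [hWm i] at h1
    have h2 : eLpNorm (Z i) k μ = ‖c‖ₑ * eLpNorm (fun ω => W i ω - m) k μ :=
      eLpNorm_const_smul c (fun ω => W i ω - m) k μ
    rw [h2, mul_assoc, ENNReal.ofReal_mul hc0.le, Real.enorm_of_nonneg hc0.le]
    gcongr
  have hexp := fun i => integral_exp_norm_sub_le (hZm i) (by positivity : 0 ≤ c * K)
    (by rw [hcK]; linarith) (hZmom i)
  have hmain := measureReal_norm_sum_ge_le (fun i => (hZm i).aemeasurable) hZind
    (fun i => (hexp i).1) hZ0 (fun i => (hexp i).2) (2.64 * Λ)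
  rw [hcK, Fintype.card_fin] at hmain
  have hfin := hmain.trans (two_mul_exp_le_of_one_le hδ1 hr0 hr1 hn0.le hΛr)
  have hδe : Real.exp (-Λ) = δ := by
    rw [hΛ, one_div, Real.log_inv, neg_neg, Real.exp_log hδ]
  rw [hδe] at hfin
  refine le_trans (measureReal_mono fun ω hω => ?_) hfin
  simp only [mem_ofPred_eq] at hω ⊢
  have hsum : ∑ i, Z i ω = (c * n) • ((1 / (n : ℝ)) • ∑ i, W i ω - m) := by
    simp only [Z]
    rw [← Finset.smul_sum, Finset.sum_sub_distrib, mul_smul, smul_sub (n : ℝ), smul_smul,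
      mul_one_div_cancel hn0.ne', one_smul]
    simp [Nat.cast_smul_eq_nsmul]
  rw [hsum, norm_smul, Real.norm_of_nonneg (by positivity)]
  calc 2.64 * Λ = c * n * (6 * Real.exp 1 * K * r) := by
        rw [hΛr, hc]; field_simp; ring
    _ ≤ _ := by gcongr

/-- Strongly measurable vectors live almost surely in a separable closed subspace `F`; projecting
onto `F` changes neither norms nor the mean, so second countability may be assumed. -/
theorem measureReal_norm_average_sub_ge_le [NeZero n]
    (hW : ∀ i, AEStronglyMeasurable (W i) μ) (hindep : iIndepFun W μ)
    (hWm : ∀ i, ∫ ω, W i ω ∂μ = m) (hK : 0 < K)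
    (hmom : ∀ i, ∀ k : ℕ, 1 ≤ k → eLpNorm (W i) k μ ≤ ENNReal.ofReal (K * k))
    (hδ : 0 < δ) (hδ1 : 1 ≤ Real.log (1 / δ)) (hn : Real.log (1 / δ) ≤ n) :
    μ.real {ω | 6 * Real.exp 1 * K * √(Real.log (1 / δ) / n) ≤ ‖(1 / (n : ℝ)) • ∑ i, W i ω - m‖}
      ≤ δ := by
  choose t ht htW using fun i => (hW i).isSeparable_ae_range
  let F : Submodule ℝ E := (Submodule.span ℝ (⋃ i, t i)).topologicalClosure
  have hFsep : TopologicalSpace.IsSeparable (F : Set E) := by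
    rw [Submodule.topologicalClosure_coe]
    exact ((TopologicalSpace.IsSeparable.iUnion ht).span (R := ℝ)).closure
  have : CompleteSpace F := (Submodule.isClosed_topologicalClosure _).completeSpace_coe
  have : TopologicalSpace.SeparableSpace F := hFsep.separableSpace
  have : SecondCountableTopology F := UniformSpace.secondCountable_of_separable F
  let Q := F.orthogonalProjectionOnto
  have hWF : ∀ i, ∀ᵐ ω ∂μ, (Q (W i ω) : E) = W i ω := fun i => by
    filter_upwards [htW i] with ω hω
    have hmem : W i ω ∈ F :=
      Submodule.le_topologicalClosure _ (Submodule.subset_span (mem_iUnion.2 ⟨i, hω⟩))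
    exact Submodule.starProjection_eq_self_iff.2 hmem
  have hWi : ∀ i, Integrable (W i) μ := fun i => by
    rw [← memLp_one_iff_integrable]
    refine ⟨hW i, ?_⟩
    have := hmom i 1 le_rfl
    rw [Nat.cast_one] at this
    exact this.trans_lt ENNReal.ofReal_lt_top
  have hQm : ∀ i, ∫ ω, Q (W i ω) ∂μ = Q m := fun i => by
    rw [ContinuousLinearMap.integral_comp_comm Q (hWi i), hWm i]
  have hm : (Q m : E) = m := by
    have h1 := (F.subtypeL).integral_comp_comm (Q.integrable_comp (hWi 0))
    rw [hQm 0] at h1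
    rw [← hWm 0]
    simp only [Submodule.subtypeL_apply] at h1
    rw [integral_congr_ae (hWF 0), hWm 0] at h1
    rw [hWm 0, ← h1]
  have hmain := measureReal_norm_average_sub_ge_le_of_secondCountable (μ := μ)
    (W := fun i ω => Q (W i ω)) (m := Q m) (δ := δ)
    (fun i => Q.continuous.comp_aestronglyMeasurable (hW i))
    (hindep.comp (fun _ => Q) fun _ => Q.continuous.measurable) hQm hK
    (fun i k hk => by
      refine le_of_eq_of_le (eLpNorm_congr_norm_ae ?_) (hmom i k hk)
      filter_upwards [hWF i] with ω hω
      rw [Submodule.coe_norm, hω]) hδ hδ1 hn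
  refine le_of_eq_of_le (measureReal_congr ?_) hmain
  filter_upwards [ae_all_iff.2 hWF] with ω hω
  have : ‖(1 / (n : ℝ)) • ∑ i, Q (W i ω) - Q m‖ = ‖(1 / (n : ℝ)) • ∑ i, W i ω - m‖ := by
    rw [Submodule.coe_norm]
    simp [hω, hm]
  apply propext
  change _ ≤ ‖_‖ ↔ _ ≤ ‖_‖
  rw [this]

/-- The strict inequality admits `K = 0`: all vectors then vanish almost surely and the event is
null. -/
theorem measureReal_norm_average_sub_gt_le [NeZero n]
    (hW : ∀ i, AEStronglyMeasurable (W i) μ) (hindep : iIndepFun W μ)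
    (hWm : ∀ i, ∫ ω, W i ω ∂μ = m) (hK : 0 ≤ K)
    (hmom : ∀ i, ∀ k : ℕ, 1 ≤ k → eLpNorm (W i) k μ ≤ ENNReal.ofReal (K * k))
    (hδ : 0 < δ) (hδ1 : 1 ≤ Real.log (1 / δ)) (hn : Real.log (1 / δ) ≤ n) :
    μ.real {ω | 6 * Real.exp 1 * K * √(Real.log (1 / δ) / n) < ‖(1 / (n : ℝ)) • ∑ i, W i ω - m‖}
      ≤ δ := by
  rcases hK.eq_or_lt with rfl | hK
  · have hW0 : ∀ i, W i =ᵐ[μ] 0 := fun i => by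
      have := hmom i 1 le_rfl
      rw [zero_mul, ENNReal.ofReal_zero, nonpos_iff_eq_zero,
        eLpNorm_eq_zero_iff (hW i) (by simp)] at this
      exact this
    have hm : m = 0 := by rw [← hWm 0, integral_congr_ae (hW0 0)]; simp
    refine le_of_eq_of_le ?_ hδ.le
    rw [measureReal_eq_zero_iff]
    refine measure_mono_null (t := {ω | ¬ ∀ i, W i ω = 0}) (fun ω hω h => ?_)
      (ae_iff.1 (ae_all_iff.2 hW0))
    simp [h, hm] at hω
  · refine (measureReal_mono ?_).trans
      (measureReal_norm_average_sub_ge_le hW hindep hWm hK hmom hδ hδ1 hn)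
    intro ω hω
    rw [mem_ofPred_eq] at hω ⊢
    exact hω.le

end Concentration

/-! ### Hilbert–Schmidt features and projections. -/

section FeatureMap

universe u v

variable (𝕜 : Type u) [RCLike 𝕜] {H : Type v} [NormedAddCommGroup H] [InnerProductSpace 𝕜 H]

/-- The Hilbert–Schmidt embedding `x ↦ x ⊗ x̄`, given abstractly by its kernel `|⟪x, y⟫|²`. -/
theorem exists_map_inner_eq_norm_inner_sq [CompleteSpace H] :
    ∃ (ι : Type v) (T : H → lp (fun _ : ι => 𝕜) 2),
      ∀ x y, inner 𝕜 (T x) (T y) = ((‖inner 𝕜 x y‖ ^ 2 : ℝ) : 𝕜) := by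
  obtain ⟨w, b, -⟩ := exists_hilbertBasis 𝕜 H
  have hsum : ∀ x : H, Summable fun i => ‖inner 𝕜 (b i) x‖ ^ 2 := fun x =>
    b.orthonormal.inner_products_summable x
  -- These are the coordinates of the rank-one operator attached to `x` in the product basis; square
  -- summability is a product of two Bessel sums.
  have hmem : ∀ x : H, Memℓp
      (fun q : w × w => inner 𝕜 (b q.1) x * inner 𝕜 x (b q.2)) 2 := fun x => by
    apply memℓp_gen
    simp only [ENNReal.toReal_ofNat, Real.rpow_ofNat, norm_mul, mul_pow]
    simp_rw [norm_inner_symm x]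
    exact (hsum x).mul_of_nonneg (hsum x) (fun _ => sq_nonneg _) fun _ => sq_nonneg _
  refine ⟨w × w, fun x => ⟨_, hmem x⟩, fun x y => ?_⟩
  refine (lp.hasSum_inner _ _).unique ?_
  have h1 := b.hasSum_inner_mul_inner x y
  have h2 := b.hasSum_inner_mul_inner y x
  have hS := lp.summable_inner (𝕜 := 𝕜) (⟨_, hmem x⟩ : lp (fun _ : w × w => 𝕜) 2) ⟨_, hmem y⟩
  have e : ∀ q : w × w, inner 𝕜 (inner 𝕜 (b q.1) x * inner 𝕜 x (b q.2))
      (inner 𝕜 (b q.1) y * inner 𝕜 y (b q.2))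
      = (inner 𝕜 x (b q.1) * inner 𝕜 (b q.1) y) * (inner 𝕜 y (b q.2) * inner 𝕜 (b q.2) x) := by
    intro q
    simp only [RCLike.inner_apply, map_mul, inner_conj_symm]
    ring
  simp only [e] at hS ⊢
  -- The double sum is the product of the Parseval sums for `⟪x, y⟫` and `⟪y, x⟫`.
  have h3 := h1.mul h2 hS
  rw [← inner_conj_symm y x, RCLike.mul_conj] at h3
  exact_mod_cast h3

/-- A real Hilbert space containing a unit vector orthogonal to a copy of the Hilbert–Schmidt
embedding. -/
theorem exists_real_map_inner_eq_norm_inner_sq [CompleteSpace H] :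
    ∃ (E : Type (max u v)) (_ : NormedAddCommGroup E) (_ : InnerProductSpace ℝ E)
      (_ : CompleteSpace E) (a : E) (T : H → E), ‖a‖ = 1 ∧ (∀ x, inner ℝ a (T x) = 0) ∧
      ∀ x y, inner ℝ (T x) (T y) = ‖inner 𝕜 x y‖ ^ 2 := by
  obtain ⟨ι, T, hT⟩ := exists_map_inner_eq_norm_inner_sq 𝕜 (H := H)
  let : InnerProductSpace ℝ (lp (fun _ : ι => 𝕜) 2) := InnerProductSpace.rclikeToReal 𝕜 _
  refine ⟨WithLp 2 (ℝ × lp (fun _ : ι => 𝕜) 2), inferInstance, inferInstance, inferInstance,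
    WithLp.toLp 2 (1, 0), fun x => WithLp.toLp 2 (0, T x), ?_, fun x => ?_, fun x y => ?_⟩
  · rw [WithLp.prod_norm_eq_of_L2]; simp
  · rw [WithLp.prod_inner_apply]; simp
  · have h := real_inner_eq_re_inner 𝕜 (T x) (T y)
    rw [hT, RCLike.ofReal_re] at h
    rw [WithLp.prod_inner_apply, ← h]
    simp

variable {𝕜}

/-- The kernel determines distances: `‖T x - T y‖² = ‖x‖⁴ - 2 |⟪x, y⟫|² + ‖y‖⁴`, which is continuous
in `x` and vanishes at `x = y`. -/
theorem continuous_of_inner_eq_norm_inner_sq {E : Type*} [NormedAddCommGroup E]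
    [InnerProductSpace ℝ E] {T : H → E} (hT : ∀ x y, inner ℝ (T x) (T y) = ‖inner 𝕜 x y‖ ^ 2) :
    Continuous T := by
  have hn : ∀ x y, ‖T x - T y‖ = √((‖x‖ ^ 2) ^ 2 - 2 * ‖inner 𝕜 x y‖ ^ 2 + (‖y‖ ^ 2) ^ 2) := by
    intro x y
    have h2 : ∀ x, ‖T x‖ ^ 2 = (‖x‖ ^ 2) ^ 2 := fun x => by
      rw [← real_inner_self_eq_norm_sq, hT, inner_self_eq_norm_sq_to_K, norm_pow, RCLike.norm_ofReal,
        abs_norm]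
    rw [← h2, ← h2, ← hT, ← norm_sub_sq_real, Real.sqrt_sq (norm_nonneg _)]
  rw [continuous_iff_continuousAt]
  intro y
  rw [ContinuousAt, tendsto_iff_norm_sub_tendsto_zero]
  simp only [hn]
  have hc : Continuous fun x : H =>
      √((‖x‖ ^ 2) ^ 2 - 2 * ‖inner 𝕜 x y‖ ^ 2 + (‖y‖ ^ 2) ^ 2) := by fun_prop
  have := hc.tendsto y
  rwa [← hn, sub_self, norm_zero] at this

/-- Pythagoras, with `‖P x‖²` expanded in an orthonormal basis of the range. -/
theorem exists_orthonormal_reconstructionError_eq [CompleteSpace H] {d : ℕ} {P : H →L[𝕜] H}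
    (hP : P ∈ orthProjections 𝕜 H d) :
    ∃ e : Fin d → H, Orthonormal 𝕜 e ∧
      ∀ x, reconstructionError P x = ‖x‖ ^ 2 - ∑ k, ‖inner 𝕜 (e k) x‖ ^ 2 := by
  obtain ⟨hstar, hrank⟩ := hP
  set U := LinearMap.range (P : H →ₗ[𝕜] H)
  obtain ⟨hproj, hPU⟩ := isStarProjection_iff_eq_starProjection_range.1 hstar
  have hfin : FiniteDimensional 𝕜 U := by
    apply Module.finite_of_rank_eq_nat hrank
  have hfr : Module.finrank 𝕜 U = d := Module.finrank_eq_of_rank_eq hrank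
  let b : OrthonormalBasis (Fin d) 𝕜 U := (stdOrthonormalBasis 𝕜 U).reindex (finCongr hfr)
  refine ⟨fun k => b k, b.orthonormal.comp_linearIsometry U.subtypeₗᵢ, fun x => ?_⟩
  have h1 : ‖x‖ ^ 2 = ‖P x‖ ^ 2 + ‖P x - x‖ ^ 2 := by
    have h := U.norm_sq_eq_add_norm_sq_starProjection x
    have hx : U.starProjection x = P x := by conv_rhs => rw [hPU]
    rw [Submodule.starProjection_orthogonal', sub_apply, one_apply_eq_self, hx] at h
    rw [h, norm_sub_rev]
  have h2 : ‖P x‖ ^ 2 = ∑ k, ‖inner 𝕜 (b k : H) x‖ ^ 2 := by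
    have h := b.sum_sq_norm_inner_right (U.orthogonalProjectionOnto x)
    have hx : P x = (U.orthogonalProjectionOnto x : H) := by
      conv_lhs => rw [hPU]
      rfl
    rw [hx, Submodule.norm_coe, ← h]
    refine Finset.sum_congr rfl fun k _ => ?_
    rw [Submodule.inner_orthogonalProjectionOnto_eq_of_mem_left]
  rw [reconstructionError, h1, h2]
  ring

end FeatureMap

/-! ### Linear moment growth from the Orlicz norm. -/

theorem IsOrliczNFunction.orliczInv_pos {φ : ℝ → ℝ} (h : IsOrliczNFunction φ) {p : ℝ}
    (hp : 0 < p) : 0 < orliczInv φ p := by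
  obtain ⟨h0, h1⟩ := h.orliczInv_spec hp.le
  refine h0.lt_of_ne fun heq => ?_
  rw [← heq, h.map_zero] at h1
  exact hp.ne h1

/-- Convexity, `φ 0 = 0` and `φ 1 = 1` give `x ≤ φ x` for `x ≥ 1`; at `x = φ^{(-1)}(p)` this reads
`x ≤ p`. -/
theorem IsOrliczNFunction.orliczInv_le_self {φ : ℝ → ℝ} (h : IsOrliczNFunction φ)
    (h1 : orliczInv φ 1 = 1) {p : ℝ} (hp : 1 ≤ p) : orliczInv φ p ≤ p := by
  by_contra! hlt
  have hφ1 : φ 1 = 1 := by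
    have := (h.orliczInv_spec zero_le_one).2
    rwa [h1] at this
  have hφp := (h.orliczInv_spec (zero_le_one.trans hp)).2
  set x := orliczInv φ p
  have hx0 : 0 < x := by linarith
  have hc := h.convex.2 (mem_univ x) (mem_univ (0 : ℝ)) (show 0 ≤ 1 / x by positivity)
    (show 0 ≤ 1 - 1 / x by rw [sub_nonneg, div_le_one hx0]; linarith) (by ring)
  simp only [smul_eq_mul, mul_zero, add_zero, h.map_zero, hφp] at hc
  rw [one_div_mul_cancel hx0.ne', hφ1, one_div_mul_eq_div, le_div_iff₀ hx0] at hc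
  linarith

theorem eLpNorm_le_momentNorm_mul {Ω : Type*} [MeasurableSpace Ω] {μ : Measure Ω} {φ : ℝ → ℝ}
    (hφ : IsOrliczNFunction φ) (h1 : orliczInv φ 1 = 1) {Y : Ω → ℝ}
    (hY : momentNorm φ μ Y ≠ ∞) {k : ℕ} (hk : 1 ≤ k) :
    eLpNorm Y k μ ≤ ENNReal.ofReal ((momentNorm φ μ Y).toReal * k) := by
  have hk1 : (1 : ℝ) ≤ k := by exact_mod_cast hk
  have hpos := hφ.orliczInv_pos (zero_lt_one.trans_le hk1)
  have hle : eLpNorm Y (ENNReal.ofReal k) μ / ENNReal.ofReal (orliczInv φ k)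
      ≤ momentNorm φ μ Y :=
    le_iSup₂ (f := fun (p : ℝ) (_ : 1 ≤ p) =>
      eLpNorm Y (ENNReal.ofReal p) μ / ENNReal.ofReal (orliczInv φ p)) (k : ℝ) hk1
  rw [ENNReal.div_le_iff (by simpa using hpos) ENNReal.ofReal_ne_top, ENNReal.ofReal_natCast] at hle
  rw [ENNReal.ofReal_mul ENNReal.toReal_nonneg, ENNReal.ofReal_toReal hY]
  exact hle.trans (mul_le_mul_right (ENNReal.ofReal_le_ofReal (hφ.orliczInv_le_self h1 hk1)) _)

/-! ### Linearisation of the reconstruction error. -/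

section Feature

variable {𝕜 : Type*} [RCLike 𝕜] {H : Type*} [NormedAddCommGroup H] [InnerProductSpace 𝕜 H]
  {E : Type*} [NormedAddCommGroup E] [InnerProductSpace ℝ E] {a : E} {T : H → E}

theorem norm_sq_smul_add_eq (ha : ‖a‖ = 1) (haT : ∀ x, inner ℝ a (T x) = 0)
    (hT : ∀ x y, inner ℝ (T x) (T y) = ‖inner 𝕜 x y‖ ^ 2) (x : H) :
    ‖(‖x‖ ^ 2) • a + T x‖ = √2 * ‖x‖ ^ 2 := by
  have h : ‖(‖x‖ ^ 2) • a + T x‖ ^ 2 = (√2 * ‖x‖ ^ 2) ^ 2 := by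
    rw [norm_add_sq_real, real_inner_smul_left, haT, norm_smul, ha,
      ← real_inner_self_eq_norm_sq (T x), hT, inner_self_eq_norm_sq_to_K, norm_pow, norm_pow,
      RCLike.norm_ofReal, abs_norm, norm_norm, mul_pow (√2), Real.sq_sqrt zero_le_two]
    ring
  exact (pow_left_inj₀ (norm_nonneg _) (by positivity) two_ne_zero).1 h

theorem exists_reconstructionError_eq_inner [CompleteSpace H] (ha : ‖a‖ = 1)
    (haT : ∀ x, inner ℝ a (T x) = 0)
    (hT : ∀ x y, inner ℝ (T x) (T y) = ‖inner 𝕜 x y‖ ^ 2) {d : ℕ} {P : H →L[𝕜] H}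
    (hP : P ∈ orthProjections 𝕜 H d) :
    ∃ A : E, ‖A‖ = √(1 + d) ∧
      ∀ x, reconstructionError P x = inner ℝ A ((‖x‖ ^ 2) • a + T x) := by
  obtain ⟨e, he, hPe⟩ := exists_orthonormal_reconstructionError_eq hP
  have haT' : ∀ x, inner ℝ (T x) a = 0 := fun x => by rw [real_inner_comm, haT]
  have haa : inner ℝ a a = 1 := by rw [real_inner_self_eq_norm_sq, ha, one_pow]
  -- The `T (e k)` are orthonormal because the kernel `|⟪e j, e k⟫|²` is again a Kronecker delta.
  refine ⟨a - ∑ k, T (e k), ?_, fun x => ?_⟩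
  · rw [eq_comm, Real.sqrt_eq_iff_eq_sq (by positivity) (norm_nonneg _), norm_sub_sq_real, ha]
    have h := orthonormal_iff_ite.1 he
    have hsum : ‖∑ k, T (e k)‖ ^ 2 = d := by
      rw [← real_inner_self_eq_norm_sq, sum_inner]
      simp only [inner_sum, hT, h, apply_ite norm]
      simp
    simp [inner_sum, haT, hsum]
  · rw [hPe, inner_sub_left, inner_add_right, inner_add_right, real_inner_smul_right,
      real_inner_smul_right, haa, haT, sum_inner, sum_inner]
    simp [haT', hT]

end Feature

/-! ### Assembly of the uniform bound. -/

theorem sqrt_one_add_mul_sqrt_two_le {d : ℕ} (hd : 1 ≤ d) : √(1 + (d : ℝ)) * √2 ≤ 2 * √d := by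
  have hd' : (1 : ℝ) ≤ d := by exact_mod_cast hd
  rw [← Real.sqrt_mul (by positivity)]
  refine Real.sqrt_le_iff.2 ⟨by positivity, ?_⟩
  rw [mul_pow, Real.sq_sqrt (by positivity)]
  linarith

theorem mainTheorem6
    {𝕜 : Type*} [RCLike 𝕜]
    {H : Type*} [NormedAddCommGroup H] [InnerProductSpace 𝕜 H] [CompleteSpace H]
    [MeasurableSpace H] [BorelSpace H]
    {Ω : Type*} [MeasurableSpace Ω] (μ : Measure Ω) [IsProbabilityMeasure μ]
    (φ : ℝ → ℝ) (hφ : IsOrliczNFunction φ) (hφ1 : orliczInv φ 1 = 1)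
    (n : ℕ) [NeZero n] (d : ℕ) (hd : 1 ≤ d)
    (X : Fin n → Ω → H)
    (hX : ∀ i, AEStronglyMeasurable (X i) μ)
    (hindep : iIndepFun X μ)
    (hident : ∀ i, IdentDistrib (X i) (X 0) μ μ)
    (hK : momentNorm φ μ (fun ω => ‖X 0 ω‖ ^ 2) ≠ ∞)
    (δ : ℝ) (hδ : 0 < δ) (hδ1 : 1 ≤ Real.log (1 / δ)) (hn : Real.log (1 / δ) ≤ n) :
    (∀ P ∈ orthProjections 𝕜 H d, Integrable (fun ω => reconstructionError P (X 0 ω)) μ) ∧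
    ∃ E : Set Ω, MeasurableSet E ∧ 1 - δ ≤ μ.real E ∧ ∀ ω ∈ E,
      (⨆ P ∈ orthProjections 𝕜 H d,
        (((1 / (n : ℝ)) * ∑ i, reconstructionError P (X i ω)
          - ∫ ω', reconstructionError P (X 0 ω') ∂μ : ℝ) : EReal))
      ≤ ((12 * √(d : ℝ) * Real.exp 1 * (momentNorm φ μ (fun ω' => ‖X 0 ω'‖ ^ 2)).toReal
          * √(Real.log (1 / δ) / n) : ℝ) : EReal) := by
  obtain ⟨E, _, _, _, a, T, ha, haT, hT⟩ := exists_real_map_inner_eq_norm_inner_sq 𝕜 (H := H)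
  borelize E
  set K := (momentNorm φ μ (fun ω => ‖X 0 ω‖ ^ 2)).toReal with hKdef
  have hK0 : 0 ≤ K := ENNReal.toReal_nonneg
  let V : H → E := fun x => (‖x‖ ^ 2) • a + T x
  have hVc : Continuous V := by
    have := continuous_of_inner_eq_norm_inner_sq hT
    fun_prop
  have hVn : ∀ x, ‖V x‖ = √2 * ‖x‖ ^ 2 := norm_sq_smul_add_eq ha haT hT
  have hVX : ∀ i, AEStronglyMeasurable (fun ω => V (X i ω)) μ := fun i =>
    hVc.comp_aestronglyMeasurable (hX i)
  have hid : ∀ i, IdentDistrib (fun ω => V (X i ω)) (fun ω => V (X 0 ω)) μ μ := fun i =>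
    (hident i).comp hVc.measurable
  have hmom : ∀ i, ∀ k : ℕ, 1 ≤ k →
      eLpNorm (fun ω => V (X i ω)) k μ ≤ ENNReal.ofReal (√2 * K * k) := by
    intro i k hk
    rw [(hid i).eLpNorm_eq]
    have h1 : eLpNorm (fun ω => V (X 0 ω)) k μ = eLpNorm (√2 • fun ω => ‖X 0 ω‖ ^ 2) k μ := by
      refine eLpNorm_congr_norm_ae (ae_of_all _ fun ω => ?_)
      rw [hVn, Pi.smul_apply, smul_eq_mul, Real.norm_of_nonneg (by positivity)]
    rw [h1, eLpNorm_const_smul, mul_assoc, ENNReal.ofReal_mul (Real.sqrt_nonneg _),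
      Real.enorm_of_nonneg (Real.sqrt_nonneg _)]
    gcongr
    exact eLpNorm_le_momentNorm_mul hφ hφ1 hK hk
  have hint : Integrable (fun ω => V (X 0 ω)) μ := by
    rw [← memLp_one_iff_integrable]
    refine ⟨hVX 0, ?_⟩
    have := hmom 0 1 le_rfl
    rw [Nat.cast_one] at this
    exact this.trans_lt ENNReal.ofReal_lt_top
  set m := ∫ ω, V (X 0 ω) ∂μ with hm
  refine ⟨fun P hP => ?_, ?_⟩
  · obtain ⟨A, -, hA⟩ := exists_reconstructionError_eq_inner ha haT hT hP
    simp only [hA]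
    exact hint.const_inner A
  have hconc := measureReal_norm_average_sub_gt_le (m := m) hVX
    (hindep.comp (fun _ => V) fun _ => hVc.measurable) (fun i => (hid i).integral_eq)
    (by positivity : 0 ≤ √2 * K) hmom hδ hδ1 hn
  set B := {ω | 6 * Real.exp 1 * (√2 * K) * √(Real.log (1 / δ) / n)
    < ‖(1 / (n : ℝ)) • ∑ i, V (X i ω) - m‖} with hB
  -- The good event is the complement of a measurable hull of `B`, which has the same measure as
  -- `B`.
  refine ⟨(toMeasurable μ B)ᶜ, (measurableSet_toMeasurable μ B).compl, ?_, fun ω hω => ?_⟩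
  · rw [probReal_compl_eq_one_sub (measurableSet_toMeasurable μ B), measureReal_def,
      measure_toMeasurable, ← measureReal_def]
    linarith
  have hωB : ‖(1 / (n : ℝ)) • ∑ i, V (X i ω) - m‖
      ≤ 6 * Real.exp 1 * (√2 * K) * √(Real.log (1 / δ) / n) := by
    by_contra! h
    exact hω (subset_toMeasurable μ B h)
  refine iSup₂_le fun P hP => EReal.coe_le_coe_iff.2 ?_
  obtain ⟨A, hAn, hA⟩ := exists_reconstructionError_eq_inner ha haT hT hP
  have hinner : (1 / (n : ℝ)) * ∑ i, reconstructionError P (X i ω)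
      - ∫ ω', reconstructionError P (X 0 ω') ∂μ
      = inner ℝ A ((1 / (n : ℝ)) • ∑ i, V (X i ω) - m) := by
    simp only [hA]
    rw [integral_inner hint, inner_sub_right, real_inner_smul_right, inner_sum]
  rw [hinner]
  calc inner ℝ A ((1 / (n : ℝ)) • ∑ i, V (X i ω) - m)
      ≤ √(1 + d) * (6 * Real.exp 1 * (√2 * K) * √(Real.log (1 / δ) / n)) := by
        refine (real_inner_le_norm _ _).trans ?_
        rw [hAn]
        gcongr
    _ = (√(1 + d) * √2) * (6 * Real.exp 1 * K * √(Real.log (1 / δ) / n)) := by ring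
    _ ≤ (2 * √d) * (6 * Real.exp 1 * K * √(Real.log (1 / δ) / n)) := by
        gcongr ?_ * _
        exact sqrt_one_add_mul_sqrt_two_le hd
    _ = _ := by ring
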